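/- Let $R$ be a local ring, that is, a commutative Noetherian ring with a unique maximal ideal, and let $N$ be a finitely generated $R$-module. Let $G(R)$ be the Grothendieck group of finitely generated $R$-modules: the free abelian group on the isomorphism classes of finitely generated $R$-modules modulo the subgroup generated by the elements $[M]-[M']-[M'']$, one for each short exact sequence $0\to M'\to M\to M''\to 0$ of finitely generated $R$-modules. Put $\overline{G}(R)=G(R)/\mathbb{Z}\cdot[R]$ and $\overline{G}(R)_{\mathbb{Q}}=\overline{G}(R)\otimes_{\mathbb{Z}}\mathbb{Q}$. Then $[N]=0$ in $\overline{G}(R)_{\mathbb{Q}}$ in each of the following cases: 1. $N$ has finite length, or $N$ is a syzygy of some finite length $R$-module $X$ (that is, there is an exact sequence $0\to N\to F_{n-1}\to\cdots\to F_0\to X\to 0$ for some $n\ge 1$ with all $F_i$ free of finite rank); 2. $R$ is Artinian; 3. $R$ is a domain of Krull dimension one; 4. $R$ is a normal domain of Krull dimension two whose divisor class group $\mathrm{Cl}(R)$ is torsion. Here $\mathrm{Cl}(R)$ is the free abelian group on the height one prime ideals of $R$ modulo the subgroup of principal divisors, which is generated by the divisors $\operatorname{div}(x)=\sum_{\mathfrak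 p}\operatorname{length}_{R_{\mathfrak p}}(R_{\mathfrak p}/xR_{\mathfrak p})\,[\mathfrak p]$ for $0\neq x\in R$. -/

import Mathlib

universe u

open scoped TensorProduct

noncomputable section

/-! ### The Grothendieck group of finitely generated modules -/

/-- Isomorphism of finitely generated `R`-modules, as an equivalence relation. -/
def fgIsoSetoid (R : Type u) [CommRing R] : Setoid (FGModuleCat.{u} R) where
  r M N := Nonempty (M ≃ₗ[R] N)
  iseqv :=
    { refl := fun M => ⟨LinearEquiv.refl R M⟩
      symm := fun ⟨e⟩ => ⟨e.symm⟩
      trans := fun ⟨e⟩ ⟨f⟩ => ⟨e.trans f⟩ }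

/-- Isomorphism classes of finitely generated `R`-modules. -/
def FGIsoClass (R : Type u) [CommRing R] : Type (u + 1) :=
  Quotient (fgIsoSetoid R)

/-- The generator, in the free abelian group on the isomorphism classes of finitely generated
`R`-modules, that belongs to the isomorphism class of `M`. -/
def freeClass (R : Type u) [CommRing R] (M : FGModuleCat.{u} R) :
    FreeAbelianGroup (FGIsoClass R) :=
  FreeAbelianGroup.of (Quotient.mk (fgIsoSetoid R) M)

/-- The subgroup generated by `[M] - [M'] - [M'']` for all short exact sequences
`0 → M' → M → M'' → 0` of finitely generated `R`-modules. -/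
def exactRelations (R : Type u) [CommRing R] :
    AddSubgroup (FreeAbelianGroup (FGIsoClass R)) :=
  AddSubgroup.closure
    {z | ∃ (M' M M'' : FGModuleCat.{u} R) (f : M' →ₗ[R] M) (g : M →ₗ[R] M''),
      Function.Injective f ∧ Function.Surjective g ∧ Function.Exact f g ∧
        z = freeClass R M - freeClass R M' - freeClass R M''}

/-- The Grothendieck group `G(R)` of finitely generated `R`-modules. -/
abbrev GrothendieckGroupFG (R : Type u) [CommRing R] : Type (u + 1) :=
  FreeAbelianGroup (FGIsoClass R) ⧸ exactRelations R

/-- The class `[M]` in `G(R)`. -/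
def grothClass (R : Type u) [CommRing R] (M : FGModuleCat.{u} R) : GrothendieckGroupFG R :=
  QuotientAddGroup.mk (freeClass R M)

/-- The reduced Grothendieck group `G(R) / ℤ[R]`. -/
abbrev ReducedGrothendieckGroup (R : Type u) [CommRing R] : Type (u + 1) :=
  GrothendieckGroupFG R ⧸ AddSubgroup.zmultiples (grothClass R (FGModuleCat.of R R))

/-- The reduced Grothendieck group tensored with `ℚ` over `ℤ`. -/
abbrev ReducedGrothendieckGroupRat (R : Type u) [CommRing R] : Type (u + 1) :=
  ReducedGrothendieckGroup R ⊗[ℤ] ℚ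

/-- The class `[M]` in the rational reduced Grothendieck group. -/
def reducedClassRat (R : Type u) [CommRing R] (M : FGModuleCat.{u} R) :
    ReducedGrothendieckGroupRat R :=
  (QuotientAddGroup.mk (grothClass R M) : ReducedGrothendieckGroup R) ⊗ₜ[ℤ] (1 : ℚ)

/-! ### Syzygies -/

/-- `IsNthSyzygy R n N X`: there is an exact sequence
`0 → N → F_{n-1} → ⋯ → F_0 → X → 0` with all `F_i` free of finite rank
(for `n = 0`: `N` is isomorphic to `X`). -/
def IsNthSyzygy (R : Type u) [CommRing R] :
    ℕ → FGModuleCat.{u} R → FGModuleCat.{u} R → Prop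
  | 0, N, X => Nonempty (N ≃ₗ[R] X)
  | n + 1, N, X =>
      ∃ (Y : FGModuleCat.{u} R) (r : ℕ) (f : Y →ₗ[R] (Fin r → R)) (g : (Fin r → R) →ₗ[R] X),
        Function.Injective f ∧ Function.Surjective g ∧ Function.Exact f g ∧ IsNthSyzygy R n N Y

/-! ### The divisor class group -/

/-- The prime ideals of height one. -/
abbrev HeightOnePrime (R : Type u) [CommRing R] : Type u :=
  {p : PrimeSpectrum R // p.asIdeal.height = 1}

/-- The order of `x` along a height one prime `p`: the length of the `R_p`-module `R_p / x R_p`.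
For `x ≠ 0` in a noetherian domain it is finite; in a noetherian normal domain it is the value
of `x` under the normalized discrete valuation of `R_p`. -/
def orderAt {R : Type u} [CommRing R] (p : HeightOnePrime R) (x : R) : ℕ :=
  (Ring.ord (Localization.AtPrime p.1.asIdeal)
    (algebraMap R (Localization.AtPrime p.1.asIdeal) x)).toNat

/-- A non-zero element has non-zero order along only finitely many height one primes. -/
theorem finite_support_orderAt {R : Type u} [CommRing R] [IsDomain R] [IsNoetherianRing R]
    (x : R) (hx : x ≠ 0) :
    (Function.support fun p : HeightOnePrime R => (orderAt p x : ℤ)).Finite := by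
  have hfin : ((Ideal.span {x}).minimalPrimes).Finite :=
    Ideal.finite_minimalPrimes_of_isNoetherianRing R _
  refine Set.Finite.of_finite_image (f := fun p : HeightOnePrime R => p.1.asIdeal)
    (hfin.subset ?_) ?_
  · rintro I ⟨p, hp, rfl⟩
    have hmem : x ∈ p.1.asIdeal := by
      by_contra hxp
      apply hp
      have hu : IsUnit (algebraMap R (Localization.AtPrime p.1.asIdeal) x) :=
        IsLocalization.map_units _ (⟨x, hxp⟩ : p.1.asIdeal.primeCompl)
      have htop : Ideal.span {algebraMap R (Localization.AtPrime p.1.asIdeal) x} = ⊤ :=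
        Ideal.span_singleton_eq_top.mpr hu
      have : Subsingleton (Localization.AtPrime p.1.asIdeal ⧸
          Ideal.span {algebraMap R (Localization.AtPrime p.1.asIdeal) x}) :=
        Ideal.Quotient.subsingleton_iff.mpr htop
      simp [orderAt, Ring.ord, Module.length_eq_zero]
    refine ⟨⟨p.1.isPrime, (Ideal.span_singleton_le_iff_mem _).mpr hmem⟩, ?_⟩
    rintro q ⟨hq, hxq⟩ hqp
    by_contra hne
    have hlt : q < p.1.asIdeal := lt_of_le_of_ne hqp fun h => hne h.ge
    have h1 : q.height < p.1.asIdeal.height :=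
      Ideal.height_strict_mono_of_isPrime hlt
    rw [p.2] at h1
    have hq0 : q = ⊥ := Ideal.height_eq_zero_iff_eq_bot.mp (Order.lt_one_iff.mp h1)
    exact hx (by simpa [hq0] using hxq (Ideal.mem_span_singleton_self x))
  · intro p _ q _ h
    exact Subtype.ext (PrimeSpectrum.ext h)

/-- The divisor `div(x) = ∑ ord_p(x) [p]` of a non-zero element `x`, in the free abelian group
on the height one primes. -/
def divisorOf {R : Type u} [CommRing R] [IsDomain R] [IsNoetherianRing R]
    (x : R) (hx : x ≠ 0) : HeightOnePrime R →₀ ℤ :=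
  Finsupp.ofSupportFinite (fun p => (orderAt p x : ℤ)) (finite_support_orderAt x hx)

/-- The subgroup of principal divisors. It is generated by the divisors of the non-zero elements
of `R`, because the divisor of a fraction `a / b` is `div(a) - div(b)`. -/
def principalDivisors (R : Type u) [CommRing R] [IsDomain R] [IsNoetherianRing R] :
    AddSubgroup (HeightOnePrime R →₀ ℤ) :=
  AddSubgroup.closure {D | ∃ (x : R) (hx : x ≠ 0), D = divisorOf x hx}

/-- The (Weil) divisor class group `Cl(R)`: divisors modulo principal divisors. This is not the
group of invertible ideals modulo principal ideals. -/
abbrev DivisorClassGroup (R : Type u) [CommRing R] [IsDomain R] [IsNoetherianRing R] : Type u :=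
  (HeightOnePrime R →₀ ℤ) ⧸ principalDivisors R

end

/-! A prime filtration reduces everything to the classes of `R ⧸ p`. The zero ideal of a domain
gives `[R] = 0`, so maximal and height one primes remain.

Maximal ideal (`moduleClass_residueField`): a module supported only at `m` has class a multiple of
`[R/m]`, a positive one if the module is nonzero. One nonzero such module of class zero therefore
kills `[R/m]` rationally. If `m` is the only prime, take `R`; otherwise take the cokernel of `x`
acting injectively on a suitable `R/P`.

Height one (`exists_divisor_moduleClass`): in dimension at most two, a torsion module has class `∑
length(M_p) [R/p]`, because `[R/m] = 0`. For `R/xR`, of class zero, this shows that `p ↦ [R/p]`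
kills principal divisors. It thus factors through `Cl(R)`, and torsion elements die over `ℚ`. -/

open IsLocalRing

/-! ### Additivity of classes and dévissage -/

section Additivity

variable {R : Type u} [CommRing R]

/-- Multiplication by `1/n` on the factor `ℚ` undoes multiplication by `n`. -/
theorem eq_zero_of_nsmul_eq_zero_tensor_rat {A : Type*} [AddCommGroup A] {n : ℕ} (hn : n ≠ 0)
    {x : A ⊗[ℤ] ℚ} (hx : n • x = 0) : x = 0 := by
  have key : ∀ y : A ⊗[ℤ] ℚ,
      LinearMap.lTensor A (LinearMap.mulLeft ℤ ((n : ℚ)⁻¹)) (n • y) = y := by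
    intro y
    induction y with
    | zero => simp
    | add y z hy hz => rw [smul_add, map_add, hy, hz]
    | tmul a q =>
      have hq : (n : ℚ) ≠ 0 := by exact_mod_cast hn
      have h : (n : ℚ)⁻¹ * (n • q) = q := by
        rw [nsmul_eq_mul]
        field_simp
      rw [← TensorProduct.tmul_smul, LinearMap.lTensor_tmul, LinearMap.mulLeft_apply, h]
  rw [← key x, hx, map_zero]

/-- The class of an unbundled finitely generated module. -/
noncomputable abbrev moduleClass (R : Type u) [CommRing R] (M : Type u) [AddCommGroup M]
    [Module R M] [Module.Finite R M] : ReducedGrothendieckGroupRat R :=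
  reducedClassRat R (FGModuleCat.of R M)

theorem reducedClassRat_exact {M' M M'' : FGModuleCat.{u} R} (f : M' →ₗ[R] M) (g : M →ₗ[R] M'')
    (hf : Function.Injective f) (hg : Function.Surjective g) (hfg : Function.Exact f g) :
    reducedClassRat R M = reducedClassRat R M' + reducedClassRat R M'' := by
  have h : grothClass R M = grothClass R M' + grothClass R M'' := by
    rw [← sub_eq_zero, ← sub_sub]
    exact (QuotientAddGroup.eq_zero_iff (freeClass R M - freeClass R M' - freeClass R M'')).2
      (AddSubgroup.subset_closure ⟨M', M, M'', f, g, hf, hg, hfg, rfl⟩)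
  unfold reducedClassRat
  rw [h, ← TensorProduct.add_tmul]
  rfl

theorem reducedClassRat_congr {M N : FGModuleCat.{u} R} (e : M ≃ₗ[R] N) :
    reducedClassRat R M = reducedClassRat R N := by
  have h : freeClass R M = freeClass R N :=
    congrArg FreeAbelianGroup.of (Quotient.sound ⟨e⟩)
  unfold reducedClassRat grothClass
  rw [h]

variable {M N P : Type u} [AddCommGroup M] [Module R M] [Module.Finite R M]
  [AddCommGroup N] [Module R N] [Module.Finite R N] [AddCommGroup P] [Module R P]
  [Module.Finite R P]

theorem moduleClass_exact (f : M →ₗ[R] N) (g : N →ₗ[R] P)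
    (hf : Function.Injective f) (hg : Function.Surjective g) (hfg : Function.Exact f g) :
    moduleClass R N = moduleClass R M + moduleClass R P :=
  reducedClassRat_exact (M' := FGModuleCat.of R M) (M := FGModuleCat.of R N)
    (M'' := FGModuleCat.of R P) f g hf hg hfg

theorem moduleClass_congr (e : M ≃ₗ[R] N) : moduleClass R M = moduleClass R N :=
  reducedClassRat_congr (M := FGModuleCat.of R M) (N := FGModuleCat.of R N) e

theorem moduleClass_of_subsingleton [Subsingleton M] : moduleClass R M = 0 := by
  have h := moduleClass_exact (R := R) (LinearMap.id : M →ₗ[R] M) (LinearMap.id : M →ₗ[R] M)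
    Function.injective_id Function.surjective_id
    (fun x => ⟨fun _ => ⟨x, rfl⟩, fun _ => Subsingleton.elim _ _⟩)
  simpa using h

variable (R) in
theorem moduleClass_self : moduleClass R R = 0 := by
  have h : (QuotientAddGroup.mk (grothClass R (FGModuleCat.of R R)) :
      ReducedGrothendieckGroup R) = 0 :=
    (QuotientAddGroup.eq_zero_iff _).2 (AddSubgroup.mem_zmultiples _)
  unfold moduleClass reducedClassRat
  rw [h, TensorProduct.zero_tmul]

variable (R) in
theorem moduleClass_fin_fun (r : ℕ) : moduleClass R (Fin r → R) = 0 := by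
  induction r with
  | zero => exact moduleClass_of_subsingleton
  | succ r ih =>
    rw [moduleClass_congr (Fin.consLinearEquiv R (fun _ : Fin (r + 1) => R)).symm,
      moduleClass_exact (LinearMap.inl R R (Fin r → R)) (LinearMap.snd R R (Fin r → R))
        LinearMap.inl_injective LinearMap.snd_surjective .inl_snd, ih, moduleClass_self, add_zero]

/-- The cokernel of an injective endomorphism has class zero. -/
theorem moduleClass_eq_zero_of_exact (f : M →ₗ[R] M) (g : M →ₗ[R] N)
    (hf : Function.Injective f) (hg : Function.Surjective g) (hfg : Function.Exact f g) :
    moduleClass R N = 0 :=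
  left_eq_add.mp (moduleClass_exact f g hf hg hfg)

theorem moduleClass_quotient_span_singleton [IsDomain R] {x : R} (hx : x ≠ 0) :
    moduleClass R (R ⧸ Ideal.span {x}) = 0 := by
  refine moduleClass_eq_zero_of_exact (LinearMap.mulLeft R x) (Ideal.span {x}).mkQ
    (mul_right_injective₀ hx) (Submodule.mkQ_surjective _) fun y => ?_
  rw [Submodule.mkQ_apply, Submodule.Quotient.mk_eq_zero, Ideal.mem_span_singleton']
  simp [mul_comm]

theorem moduleClass_eq_zero_of_isNthSyzygy {n : ℕ} {X Y : FGModuleCat.{u} R}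
    (h : IsNthSyzygy R n Y X) (hX : reducedClassRat R X = 0) : reducedClassRat R Y = 0 := by
  induction n generalizing X with
  | zero =>
    obtain ⟨e⟩ := h
    rw [reducedClassRat_congr e, hX]
  | succ n ih =>
    obtain ⟨Z, r, f, g, hf, hg, hfg, hZ⟩ := h
    refine ih hZ ?_
    have := reducedClassRat_exact (M' := Z) (M := FGModuleCat.of R (Fin r → R)) (M'' := X)
      f g hf hg hfg
    rwa [hX, add_zero, show reducedClassRat R (FGModuleCat.of R (Fin r → R)) = 0 from
      moduleClass_fin_fun R r, eq_comm] at this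

/-- Dévissage: the class of a module vanishes if the classes of all `R ⧸ p` do. -/
theorem moduleClass_eq_zero_of_forall_prime [IsNoetherianRing R]
    (h : ∀ p : PrimeSpectrum R, moduleClass R (R ⧸ p.asIdeal) = 0) : moduleClass R M = 0 := by
  induction ‹Module.Finite R M› using
    IsNoetherianRing.induction_on_isQuotientEquivQuotientPrime R with
  | subsingleton N => exact moduleClass_of_subsingleton
  | quotient N p e => rw [moduleClass_congr e, h p]
  | exact N₁ N₂ N₃ f g hf hg hfg h₁ h₃ => rw [moduleClass_exact f g hf hg hfg, h₁, h₃, add_zero]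

theorem moduleClass_quotient_of_eq_bot {I : Ideal R} (hI : I = ⊥) :
    moduleClass R (R ⧸ I) = 0 := by
  subst hI
  rw [moduleClass_congr (Submodule.quotEquivOfEqBot (⊥ : Ideal R) rfl), moduleClass_self]

end Additivity

/-! ### Modules of finite length and the residue field -/

section FiniteLength

variable {R : Type u} [CommRing R]

theorem Module.support_quotient_ideal (I : Ideal R) :
    Module.support R (R ⧸ I) = PrimeSpectrum.zeroLocus I := by
  rw [Module.support_eq_zeroLocus, Ideal.annihilator_quotient]

variable [IsLocalRing R]

theorem support_subset_of_isFiniteLength {M : Type*} [AddCommGroup M] [Module R M]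
    (h : IsFiniteLength R M) : Module.support R M ⊆ {closedPoint R} := by
  induction h with
  | of_subsingleton => simp [Module.support_eq_empty]
  | @of_simple_quotient M _ _ N _ _ ih =>
    obtain ⟨I, hI, ⟨e⟩⟩ := isSimpleModule_iff_quot_maximal.mp ‹IsSimpleModule R (M ⧸ N)›
    rw [Module.support_of_exact (LinearMap.exact_subtype_mkQ N) N.injective_subtype
      N.mkQ_surjective, Set.union_subset_iff]
    refine ⟨ih, ?_⟩
    rw [e.support_eq, Module.support_quotient_ideal]
    intro p hp
    exact PrimeSpectrum.ext ((hI.eq_of_le p.2.ne_top hp).symm.trans (eq_maximalIdeal hI))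

variable [IsNoetherianRing R] {M : Type u} [AddCommGroup M] [Module R M] [Module.Finite R M]

/-- Every factor of a prime filtration is `R/m`, and `n` counts them. Its nonvanishing is recorded
so that `n` can later be divided out. -/
theorem exists_moduleClass_eq_nsmul (h : Module.support R M ⊆ {closedPoint R}) :
    ∃ n : ℕ, moduleClass R M = n • moduleClass R (R ⧸ maximalIdeal R) ∧
      (Nontrivial M → n ≠ 0) := by
  induction ‹Module.Finite R M› using
    IsNoetherianRing.induction_on_isQuotientEquivQuotientPrime R with
  | subsingleton N =>
    exact ⟨0, by rw [moduleClass_of_subsingleton, zero_smul],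
      fun hN => (not_nontrivial N hN).elim⟩
  | quotient N p e =>
    rw [e.support_eq, Module.support_quotient_ideal] at h
    obtain rfl : p = closedPoint R := h (Set.Subset.refl (p.asIdeal : Set R))
    exact ⟨1, by rw [one_smul]; exact moduleClass_congr e, fun _ => one_ne_zero⟩
  | exact N₁ N₂ N₃ f g hf hg hfg h₁ h₃ =>
    rw [Module.support_of_exact hfg hf hg, Set.union_subset_iff] at h
    obtain ⟨a, ha, ha'⟩ := h₁ h.1
    obtain ⟨b, hb, hb'⟩ := h₃ h.2
    refine ⟨a + b, by rw [moduleClass_exact f g hf hg hfg, ha, hb, add_smul], fun hN h0 => ?_⟩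
    have h₁ : Subsingleton N₁ := not_nontrivial_iff_subsingleton.mp fun h => ha' h (by lia)
    have h₃ : Subsingleton N₃ := not_nontrivial_iff_subsingleton.mp fun h => hb' h (by lia)
    obtain ⟨x, hx⟩ := exists_ne (0 : N₂)
    obtain ⟨y, rfl⟩ := (hfg x).1 (Subsingleton.elim _ _)
    exact hx (by rw [Subsingleton.elim y 0, map_zero])

theorem moduleClass_residueField_eq_zero_of_nontrivial [Nontrivial M]
    (h : Module.support R M ⊆ {closedPoint R}) (hM : moduleClass R M = 0) :
    moduleClass R (R ⧸ maximalIdeal R) = 0 := by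
  obtain ⟨n, hn, hn'⟩ := exists_moduleClass_eq_nsmul h
  exact eq_zero_of_nsmul_eq_zero_tensor_rat (hn' ‹_›) (hn ▸ hM)

variable (R) in
theorem moduleClass_residueField : moduleClass R (R ⧸ maximalIdeal R) = 0 := by
  by_cases h : ∀ p : PrimeSpectrum R, p = closedPoint R
  · exact moduleClass_residueField_eq_zero_of_nontrivial (fun p _ => h p) (moduleClass_self R)
  push Not at h
  -- `P` is maximal among the nonmaximal primes, so for `x ∈ m \ P` the only prime containing `P +
  -- (x)` is `m`.
  obtain ⟨P, hP, hmax⟩ := (InvImage.wf PrimeSpectrum.asIdeal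
    (wellFounded_gt (α := Ideal R))).has_min {p | p ≠ closedPoint R} h
  have hlt : ¬ maximalIdeal R ≤ P.asIdeal := fun hle =>
    hP (PrimeSpectrum.ext (le_antisymm (le_maximalIdeal P.2.ne_top) hle))
  obtain ⟨x, hxm, hxP⟩ := Set.not_subset.mp hlt
  have hne : P.asIdeal ⊔ Ideal.span {x} ≤ maximalIdeal R :=
    sup_le (le_maximalIdeal P.2.ne_top) ((Ideal.span_singleton_le_iff_mem _).2 hxm)
  have : Nontrivial (R ⧸ (P.asIdeal ⊔ Ideal.span {x})) :=
    Ideal.Quotient.nontrivial_iff.2 (ne_top_of_le_ne_top (maximalIdeal.isMaximal R).ne_top hne)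
  refine moduleClass_residueField_eq_zero_of_nontrivial
    (M := R ⧸ (P.asIdeal ⊔ Ideal.span {x})) (fun q hq => ?_) ?_
  · rw [Module.support_quotient_ideal] at hq
    have hq' : P.asIdeal ⊔ Ideal.span {x} ≤ q.asIdeal := hq
    by_contra hqm
    refine hmax q hqm (lt_of_le_of_ne (show P.asIdeal ≤ q.asIdeal from le_sup_left.trans hq') ?_)
    intro hPq
    exact hxP (hPq ▸ hq' (Ideal.mem_sup_right (Ideal.mem_span_singleton_self x)))
  -- Multiplication by `x ∉ P` is injective on the domain `R/P`, with cokernel `R/(P + (x))`.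
  · refine moduleClass_eq_zero_of_exact (M := R ⧸ P.asIdeal)
      (LinearMap.lsmul R (R ⧸ P.asIdeal) x) (Submodule.factor le_sup_left) ?_
      (Submodule.factor_surjective _) ?_
    · rw [injective_iff_map_eq_zero]
      intro y hy
      obtain ⟨y, rfl⟩ := Ideal.Quotient.mk_surjective y
      have hy : Ideal.Quotient.mk P.asIdeal (x * y) = 0 := hy
      rw [Ideal.Quotient.eq_zero_iff_mem] at hy ⊢
      exact (P.2.mem_or_mem hy).resolve_left hxP
    · intro y
      obtain ⟨y, rfl⟩ := Ideal.Quotient.mk_surjective y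
      have e1 : Submodule.factor (le_sup_left : P.asIdeal ≤ P.asIdeal ⊔ Ideal.span {x})
        (Ideal.Quotient.mk P.asIdeal y) = Ideal.Quotient.mk _ y := rfl
      rw [e1, Ideal.Quotient.eq_zero_iff_mem]
      constructor
      · intro hy
        obtain ⟨a, ha, b, hb, rfl⟩ := Submodule.mem_sup.mp hy
        obtain ⟨c, rfl⟩ := Ideal.mem_span_singleton'.mp hb
        refine ⟨Ideal.Quotient.mk _ c, ?_⟩
        change Ideal.Quotient.mk P.asIdeal (x * c) = _
        rw [Ideal.Quotient.eq, ← neg_mem_iff]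
        convert! ha using 1
        ring
      · rintro ⟨c, hc⟩
        obtain ⟨c, rfl⟩ := Ideal.Quotient.mk_surjective c
        have hc : Ideal.Quotient.mk P.asIdeal (x * c) = Ideal.Quotient.mk P.asIdeal y := hc
        rw [Ideal.Quotient.eq, ← neg_mem_iff] at hc
        have : y = -(x * c - y) + c * x := by ring
        rw [this]
        exact Submodule.add_mem_sup hc (Ideal.mem_span_singleton'.2 ⟨c, rfl⟩)

theorem moduleClass_eq_zero_of_isFiniteLength (h : IsFiniteLength R M) : moduleClass R M = 0 := by
  obtain ⟨n, hn, -⟩ := exists_moduleClass_eq_nsmul (support_subset_of_isFiniteLength h)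
  rw [hn, moduleClass_residueField, smul_zero]

end FiniteLength

/-! ### Primes in local domains of small dimension -/

section Domain

variable {R : Type u} [CommRing R] [IsDomain R]

variable [IsLocalRing R] [IsNoetherianRing R]

/-- In a local domain of dimension at most two, a prime is zero, or of height one, or maximal. -/
theorem prime_eq_bot_or_height_eq_one_or_eq_maximalIdeal (hR : ringKrullDim R ≤ 2)
    (p : PrimeSpectrum R) :
    p.asIdeal = ⊥ ∨ p.asIdeal.height = 1 ∨ p.asIdeal = maximalIdeal R := by
  by_contra! h
  obtain ⟨h0, h1, hm⟩ := h
  have hlt : p.asIdeal < maximalIdeal R := lt_of_le_of_ne (le_maximalIdeal p.2.ne_top) hm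
  have hh := Ideal.height_strict_mono_of_isPrime hlt
  rw [← maximalIdeal_height_eq_ringKrullDim] at hR
  have hR' : (maximalIdeal R).height ≤ 2 := WithBot.coe_le_coe.mp hR
  have h2 : p.asIdeal.height < 2 := hh.trans_le hR'
  have h3 : p.asIdeal.height ≤ 1 := Order.le_of_lt_add_one (by simpa [one_add_one_eq_two] using h2)
  exact h0 (Ideal.height_eq_zero_iff_eq_bot.mp (Order.lt_one_iff.mp (lt_of_le_of_ne h3 h1)))

theorem prime_eq_bot_or_eq_maximalIdeal (hR : ringKrullDim R ≤ 1) (p : PrimeSpectrum R) :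
    p.asIdeal = ⊥ ∨ p.asIdeal = maximalIdeal R := by
  by_contra! h
  obtain ⟨h0, hm⟩ := h
  have hlt : p.asIdeal < maximalIdeal R := lt_of_le_of_ne (le_maximalIdeal p.2.ne_top) hm
  have hh := Ideal.height_strict_mono_of_isPrime hlt
  rw [← maximalIdeal_height_eq_ringKrullDim] at hR
  have hR' : (maximalIdeal R).height ≤ 1 := WithBot.coe_le_coe.mp hR
  exact h0 (Ideal.height_eq_zero_iff_eq_bot.mp (Order.lt_one_iff.mp (hh.trans_le hR')))

end Domain

/-! ### Local lengths, divisors and classes -/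

section Divisor

variable {R : Type u} [CommRing R]

/-- The length of the localization of a module at a prime. -/
noncomputable def lengthAtPrime (p : Ideal R) [p.IsPrime] (M : Type*) [AddCommGroup M]
    [Module R M] : ℕ∞ :=
  Module.length (Localization.AtPrime p) (LocalizedModule p.primeCompl M)

theorem lengthAtPrime_exact (p : Ideal R) [p.IsPrime] {M N P : Type*} [AddCommGroup M]
    [Module R M] [AddCommGroup N] [Module R N] [AddCommGroup P] [Module R P]
    (f : M →ₗ[R] N) (g : N →ₗ[R] P) (hf : Function.Injective f) (hg : Function.Surjective g)
    (hfg : Function.Exact f g) :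
    lengthAtPrime p N = lengthAtPrime p M + lengthAtPrime p P :=
  Module.length_eq_add_of_exact (LocalizedModule.map p.primeCompl f)
    (LocalizedModule.map p.primeCompl g)
    (IsLocalizedModule.map_injective p.primeCompl (LocalizedModule.mkLinearMap _ M)
      (LocalizedModule.mkLinearMap _ N) f hf)
    (IsLocalizedModule.map_surjective p.primeCompl (LocalizedModule.mkLinearMap _ N)
      (LocalizedModule.mkLinearMap _ P) g hg)
    (LocalizedModule.map_exact p.primeCompl f g hfg)

theorem lengthAtPrime_eq_zero {p : PrimeSpectrum R} {M : Type*} [AddCommGroup M] [Module R M]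
    (h : p ∉ Module.support R M) : lengthAtPrime p.asIdeal M = 0 :=
  Module.length_eq_zero_iff.mpr (Module.notMem_support_iff.mp h)

theorem lengthAtPrime_congr (p : Ideal R) [p.IsPrime] {M N : Type*} [AddCommGroup M]
    [Module R M] [AddCommGroup N] [Module R N] (e : M ≃ₗ[R] N) :
    lengthAtPrime p M = lengthAtPrime p N :=
  (IsLocalizedModule.mapEquiv p.primeCompl (LocalizedModule.mkLinearMap _ M)
    (LocalizedModule.mkLinearMap _ N) (Localization.AtPrime p) e).length_eq

theorem lengthAtPrime_quotient (p : Ideal R) [p.IsPrime] (I : Ideal R) :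
    lengthAtPrime p (R ⧸ I) = Module.length (Localization.AtPrime p)
      (Localization.AtPrime p ⧸ I.map (algebraMap R (Localization.AtPrime p))) :=
  (LocalizedModule.equivTensorProduct p.primeCompl (R ⧸ I) ≪≫ₗ
    (I.qoutMapEquivTensorQout (Localization.AtPrime p)).symm).length_eq

theorem lengthAtPrime_quotient_span_singleton (p : Ideal R) [p.IsPrime] (x : R) :
    lengthAtPrime p (R ⧸ Ideal.span {x}) =
      Ring.ord (Localization.AtPrime p) (algebraMap R (Localization.AtPrime p) x) := by
  rw [lengthAtPrime_quotient, Ideal.map_span, Set.image_singleton, Ring.ord]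

theorem lengthAtPrime_quotient_self (p : Ideal R) [p.IsPrime] :
    lengthAtPrime p (R ⧸ p) = 1 := by
  rw [lengthAtPrime_quotient, Module.length_eq_one_iff, isSimpleModule_iff_quot_maximal]
  exact ⟨_, (Localization.AtPrime.map_eq_maximalIdeal (I := p)).symm ▸ maximalIdeal.isMaximal _,
    ⟨LinearEquiv.refl _ _⟩⟩

variable (R) in
/-- The homomorphism sending a height one prime `p` to the class of `R ⧸ p`. -/
noncomputable def divisorClassHom : (HeightOnePrime R →₀ ℤ) →+ ReducedGrothendieckGroupRat R :=
  Finsupp.liftAddHom fun p => zmultiplesHom _ (moduleClass R (R ⧸ p.1.asIdeal))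

theorem divisorClassHom_single (p : HeightOnePrime R) (n : ℤ) :
    divisorClassHom R (Finsupp.single p n) = n • moduleClass R (R ⧸ p.1.asIdeal) := by
  simp [divisorClassHom]

variable [IsNoetherianRing R]

theorem lengthAtPrime_quotient_of_height_eq {p q : HeightOnePrime R} (hpq : p ≠ q) :
    lengthAtPrime q.1.asIdeal (R ⧸ p.1.asIdeal) = 0 := by
  refine lengthAtPrime_eq_zero fun hq => ?_
  rw [Module.support_quotient_ideal] at hq
  have hle : p.1.asIdeal ≤ q.1.asIdeal := hq
  refine hpq (Subtype.ext (PrimeSpectrum.ext (by_contra fun hne => ?_)))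
  have := Ideal.height_strict_mono_of_isPrime (lt_of_le_of_ne hle hne)
  rw [p.2, q.2] at this
  exact lt_irrefl _ this

variable [IsDomain R] [IsLocalRing R]

/-- In dimension at most two, the class of a torsion module is given by its divisor. -/
theorem exists_divisor_moduleClass (hR : ringKrullDim R ≤ 2) {M : Type u} [AddCommGroup M]
    [Module R M] [Module.Finite R M] (hM : ⊥ ∉ Module.support R M) :
    ∃ D : HeightOnePrime R →₀ ℤ,
      (∀ p, ∃ n : ℕ, D p = n ∧ lengthAtPrime p.1.asIdeal M = n) ∧
      moduleClass R M = divisorClassHom R D := by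
  -- Local lengths and classes are both additive, so only the factors `R/p` need checking. The
  -- natural number `n` also carries the finiteness of the local length.
  induction ‹Module.Finite R M› using
    IsNoetherianRing.induction_on_isQuotientEquivQuotientPrime R with
  | subsingleton N =>
    refine ⟨0, fun p => ⟨0, rfl, lengthAtPrime_eq_zero ?_⟩, ?_⟩
    · simp [Module.support_eq_empty]
    · rw [moduleClass_of_subsingleton, map_zero]
  | quotient N p e =>
    have hp : p.asIdeal ≠ ⊥ := fun h => hM <| by
      rw [e.support_eq, Module.support_quotient_ideal]
      exact h.le
    rw [moduleClass_congr e]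
    by_cases h : p.asIdeal.height = 1
    · classical
      refine ⟨Finsupp.single ⟨p, h⟩ 1, fun q => ?_, by rw [divisorClassHom_single, one_smul]⟩
      rw [lengthAtPrime_congr _ e]
      by_cases hq : ⟨p, h⟩ = q
      · subst hq
        exact ⟨1, by simp, lengthAtPrime_quotient_self _⟩
      · exact ⟨0, by simp [hq], lengthAtPrime_quotient_of_height_eq (p := ⟨p, h⟩) hq⟩
    -- Here `p = m`: its localizations at height one primes vanish, and so does its class, so `D =
    -- 0` works.
    · obtain rfl : p = closedPoint R := PrimeSpectrum.ext
        (((prime_eq_bot_or_height_eq_one_or_eq_maximalIdeal hR p).resolve_left hp).resolve_left h)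
      refine ⟨0, fun q => ⟨0, rfl, lengthAtPrime_eq_zero fun hq => h ?_⟩, ?_⟩
      · rw [e.support_eq, Module.support_quotient_ideal] at hq
        have hq' : maximalIdeal R ≤ q.1.asIdeal := hq
        exact (congrArg Ideal.height (le_antisymm hq' (le_maximalIdeal q.1.2.ne_top))).trans q.2
      · rw [map_zero]
        exact moduleClass_residueField R
  | exact N₁ N₂ N₃ f g hf hg hfg h₁ h₃ =>
    rw [Module.support_of_exact hfg hf hg, Set.mem_union, not_or] at hM
    obtain ⟨D₁, hD₁, hc₁⟩ := h₁ hM.1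
    obtain ⟨D₃, hD₃, hc₃⟩ := h₃ hM.2
    refine ⟨D₁ + D₃, fun p => ?_, by rw [moduleClass_exact f g hf hg hfg, hc₁, hc₃, map_add]⟩
    obtain ⟨a, ha, ha'⟩ := hD₁ p
    obtain ⟨b, hb, hb'⟩ := hD₃ p
    exact ⟨a + b, by simp [ha, hb], by
      rw [lengthAtPrime_exact _ f g hf hg hfg, ha', hb', Nat.cast_add]⟩

/-- The divisor attached to the torsion module `R/xR` is `div(x)`, and its class is zero since it is
the cokernel of an injective endomorphism of `R`. -/
theorem divisorClassHom_divisorOf (hR : ringKrullDim R ≤ 2) (x : R) (hx : x ≠ 0) :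
    divisorClassHom R (divisorOf x hx) = 0 := by
  have hM : (⊥ : PrimeSpectrum R) ∉ Module.support R (R ⧸ Ideal.span {x}) := fun h => by
    rw [Module.support_quotient_ideal] at h
    exact hx (h (Ideal.mem_span_singleton_self x))
  obtain ⟨D, hD, hc⟩ := exists_divisor_moduleClass hR hM
  have : divisorOf x hx = D := by
    ext p
    obtain ⟨n, hn, hn'⟩ := hD p
    rw [lengthAtPrime_quotient_span_singleton] at hn'
    change ((orderAt p x : ℕ) : ℤ) = _
    -- The order is the finite value `n`, so `toNat` loses nothing.
    rw [hn, orderAt, hn', ENat.toNat_natCast]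
  rw [this, ← hc, moduleClass_quotient_span_singleton hx]

theorem divisorClassHom_eq_zero_of_mem (hR : ringKrullDim R ≤ 2) {D : HeightOnePrime R →₀ ℤ}
    (hD : D ∈ principalDivisors R) : divisorClassHom R D = 0 := by
  refine (AddSubgroup.closure_le (divisorClassHom R).ker).2 ?_ hD
  rintro _ ⟨x, hx, rfl⟩
  exact divisorClassHom_divisorOf hR x hx

/-- A positive multiple of the divisor `p` is principal, so the same multiple of `[R/p]` vanishes
and can be divided out over `ℚ`. -/
theorem moduleClass_quotient_eq_zero_of_torsion (hR : ringKrullDim R ≤ 2)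
    (hCl : IsAddTorsion (DivisorClassGroup R)) (p : HeightOnePrime R) :
    moduleClass R (R ⧸ p.1.asIdeal) = 0 := by
  obtain ⟨n, hn, h⟩ := isOfFinAddOrder_iff_nsmul_eq_zero.mp
    (hCl (QuotientAddGroup.mk (Finsupp.single p 1)))
  have hmem : n • Finsupp.single p (1 : ℤ) ∈ principalDivisors R :=
    (QuotientAddGroup.eq_zero_iff _).1 h
  have h0 := divisorClassHom_eq_zero_of_mem hR hmem
  rw [map_nsmul, divisorClassHom_single, one_smul] at h0
  exact eq_zero_of_nsmul_eq_zero_tensor_rat hn.ne' h0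

end Divisor

/-! ### The four cases -/

theorem mainTheorem11 (R : Type u) [CommRing R] [IsNoetherianRing R] [IsLocalRing R]
    (N : Type u) [AddCommGroup N] [Module R N] [Module.Finite R N] :
    ((IsFiniteLength R N ∨
        ∃ (X : FGModuleCat.{u} R) (n : ℕ),
          IsFiniteLength R X ∧ IsNthSyzygy R n (FGModuleCat.of R N) X) →
      reducedClassRat R (FGModuleCat.of R N) = 0) ∧
    (IsArtinianRing R → reducedClassRat R (FGModuleCat.of R N) = 0) ∧
    (IsDomain R → ringKrullDim R = 1 → reducedClassRat R (FGModuleCat.of R N) = 0) ∧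
    (∀ [IsDomain R], IsIntegrallyClosed R → ringKrullDim R = 2 →
      IsAddTorsion (DivisorClassGroup R) →
      reducedClassRat R (FGModuleCat.of R N) = 0) := by
  refine ⟨?_, fun _ => ?_, fun _ hR => ?_, fun _ hR hCl => ?_⟩
  · rintro (h | ⟨X, n, hX, h⟩)
    · exact moduleClass_eq_zero_of_isFiniteLength h
    · exact moduleClass_eq_zero_of_isNthSyzygy h
        (moduleClass_eq_zero_of_isFiniteLength (M := X) hX)
  · exact moduleClass_eq_zero_of_isFiniteLength
      (isFiniteLength_iff_isNoetherian_isArtinian.mpr ⟨inferInstance, inferInstance⟩)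
  · refine moduleClass_eq_zero_of_forall_prime fun p => ?_
    obtain h | h := prime_eq_bot_or_eq_maximalIdeal hR.le p
    · exact moduleClass_quotient_of_eq_bot h
    · obtain rfl : p = closedPoint R := PrimeSpectrum.ext h
      exact moduleClass_residueField R
  · refine moduleClass_eq_zero_of_forall_prime fun p => ?_
    obtain h | h | h := prime_eq_bot_or_height_eq_one_or_eq_maximalIdeal hR.le p
    · exact moduleClass_quotient_of_eq_bot h
    · exact moduleClass_quotient_eq_zero_of_torsion hR.le hCl ⟨p, h⟩
    · obtain rfl : p = closedPoint R := PrimeSpectrum.ext h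
      exact moduleClass_residueField R
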